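/- Let $m\ge 1$ and consider the control system $$y_t=f(\theta,\varphi_{t-1})+f'(u_{t-1},\varphi_{t-1})+w_t,\qquad t\ge 1,\qquad \varphi_t=(y_t,\dots,y_{t-m+1})\in\mathbb R^{pm},$$ with outputs $y_t\in\mathbb R^p$, inputs $u_t\in\mathbb R^r$ and an unknown non-random parameter $\theta$ in a known nondegenerate compact hyperrectangle $\Theta\subset\mathbb R^n$. Norms are Euclidean, $B(z,d)$ is the open ball and $\overline{B(z,d)}$ the closed ball. Assume: (A1) $\{w_t\}_{t\ge1}$ is an i.i.d. sequence such that, for each $t\ge1$, $w_t$ is independent of the past, i.e. of the $\sigma$-algebra generated by $\varphi_0$, $u_0,\dots,u_{t-1}$ and $w_1,\dots,w_{t-1}$; moreover, for some finite $C_w>0$, $\|w_1\|\le C_w$ a.s. and $\inf_{z\in\overline{B(0,C_w)}}P(w_1\in B(z,\delta))>0$ for all $\delta>0$. (A2) $f:\mathbb R^n\times\mathbb R^{pm}\to\mathbb R^p$ and $f':\mathbb R^r\times\mathbb R^{pm}\to\mathbb R^p$ are continuous. Let $(\varphi_0,\{u_t\}_{t\ge0})$ be an experiment with $\|u_t\|\le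 C_u$ a.s. for $t\ge1$, where $C_u>0$, and with $P\{\|\varphi_t\|\le C \text{ infinitely often}\}=1$ for some $C>0$. Since inputs may be generated by feedback, the experiment may depend on the true parameter; these conditions, with the same $C_u$ and $C$, are required for every value of the true parameter in $\Theta$. Then there is a constant $C_0>0$ such that, for every value $\theta\in\Theta$ of the true parameter, almost surely, for all $t\ge1$, $$\|\varphi_t\|\le C\ \Longrightarrow\ \|f(\theta,\varphi_i)+f'(u_i,\varphi_i)\|\le C_0,\quad i=t,\dots,t+m-1. \tag{1}$$ Let $C_0>0$ be any constant with property (1), and put $\mathcal S=\prod_{j=1}^m\overline{B(0,C_0)}\subset\mathbb R^{pm}$. If for all $x\ne x'$ in $\Theta$ $$\underline d^m\big(\{\beta\in\mathbb R^{pm}: f(x,\beta)\ne f(x',\beta)\}\,\big|\,\mathcal S\big)>\frac1{C_w},$$ then the system is identifiable under the experiment. Here, for $Z,Z'\subset\mathbb R^p$, $\underline d(Z'|Z)=1/\sup_{z\in Z}\inf\{d>0:B(z,d)\cap Z'\neq\emptyset\}\in[0,\infty]$ (with $\inf\emptyset=\infty$, $1/\infty=0$, $1/0=\infty$), and for $Z=\prod_{j=1}^mZ_j$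 with $Z_j\subset\mathbb R^p$ and $Z'\subset\mathbb R^{pm}$, $\underline d^m(Z'|Z)=\sup\{\min_{1\le j\le m}\underline d(E_j|Z_j): E_j\subset\mathbb R^p,\ \prod_{j=1}^mE_j\subset Z'\}$. The system is identifiable under the experiment if there is an estimator, i.e. a sequence of measurable functions $\hat\theta_t=\hat\theta_t(y_1,u_0,\dots,y_t,u_{t-1})$ not depending on $\theta$, such that $\hat\theta_t\to\theta$ almost surely for every value $\theta\in\Theta$ of the true parameter; so $\theta$ is determined by the data $\{y_{t+1},u_t\}_{t\ge0}$ with probability $1$. -/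

import Mathlib

open MeasureTheory ProbabilityTheory Filter Topology
open scoped ENNReal

noncomputable section

namespace ControlSystem

/-- The Euclidean space `ℝ^k`. -/
abbrev Vec (k : ℕ) : Type := EuclideanSpace ℝ (Fin k)

/-- Regressors `(z_1, …, z_m)` with `z_j ∈ ℝ^p`, i.e. `ℝ^{pm}` with its Euclidean norm. -/
abbrev Regressor (p m : ℕ) : Type := PiLp 2 (fun _ : Fin m => Vec p)

/-- The regressor `(y, z_1, …, z_{m-1})` obtained from `(z_1, …, z_m)` when the new output `y`
arrives. -/
def push {p m : ℕ} (y : Vec p) (φ : Regressor p m) : Regressor p m :=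
  WithLp.toLp 2 fun j : Fin m =>
    if (j : ℕ) = 0 then y else φ ⟨(j : ℕ) - 1, lt_of_le_of_lt (Nat.sub_le _ _) j.isLt⟩

/-- The regressor `φ_t = (y_t, …, y_{t-m+1})` of the system
`y_t = f(θ, φ_{t-1}) + f'(u_{t-1}, φ_{t-1}) + w_t`, `t ≥ 1`, started at `φ_0`
(the value `w 0` plays no role). -/
def regressor {n r p m : ℕ} (f : Vec n → Regressor p m → Vec p)
    (f' : Vec r → Regressor p m → Vec p) (θ : Vec n) (φ₀ : Regressor p m)
    (u : ℕ → Vec r) (w : ℕ → Vec p) : ℕ → Regressor p m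
  | 0 => φ₀
  | t + 1 =>
    push (f θ (regressor f f' θ φ₀ u w t) + f' (u t) (regressor f f' θ φ₀ u w t) + w (t + 1))
      (regressor f f' θ φ₀ u w t)

/-- An experiment `(φ_0, {u_t}_{t ≥ 0})`: a random initial regressor and random inputs. -/
structure Experiment (Ω : Type*) (r p m : ℕ) where
  init : Ω → Regressor p m
  input : ℕ → Ω → Vec r

section Trajectories

variable {Ω : Type*} {n r p m : ℕ}

/-- `φ_t` along the experiment `e`, when the true parameter is `θ`. -/
def phi (f : Vec n → Regressor p m → Vec p) (f' : Vec r → Regressor p m → Vec p)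
    (θ : Vec n) (e : Experiment Ω r p m) (w : ℕ → Ω → Vec p) (t : ℕ) (ω : Ω) : Regressor p m :=
  regressor f f' θ (e.init ω) (fun s => e.input s ω) (fun s => w s ω) t

/-- The noise-free part `f(θ, φ_t) + f'(u_t, φ_t)` of `y_{t+1}`. -/
def drift (f : Vec n → Regressor p m → Vec p) (f' : Vec r → Regressor p m → Vec p)
    (θ : Vec n) (e : Experiment Ω r p m) (w : ℕ → Ω → Vec p) (t : ℕ) (ω : Ω) : Vec p :=
  f θ (phi f f' θ e w t ω) + f' (e.input t ω) (phi f f' θ e w t ω)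

/-- The first `t` data `(y_{s+1}, u_s)`, `0 ≤ s < t`. -/
def data (f : Vec n → Regressor p m → Vec p) (f' : Vec r → Regressor p m → Vec p)
    (θ : Vec n) (e : Experiment Ω r p m) (w : ℕ → Ω → Vec p) (t : ℕ) (ω : Ω) :
    Fin t → Vec p × Vec r :=
  fun s => (drift f f' θ e w s ω + w (s + 1) ω, e.input s ω)

/-- The σ-algebra of the past before `w_t` acts, generated by
`φ_0`, `u_0, …, u_{t-1}` and `w_1, …, w_{t-1}`. -/
@[reducible] def past (e : Experiment Ω r p m) (w : ℕ → Ω → Vec p) (t : ℕ) : MeasurableSpace Ω :=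
  MeasurableSpace.comap e.init inferInstance ⊔
    (⨆ i : ℕ, ⨆ _ : i < t, MeasurableSpace.comap (e.input i) inferInstance) ⊔
    (⨆ i : ℕ, ⨆ _ : 1 ≤ i ∧ i < t, MeasurableSpace.comap (w i) inferInstance)

end Trajectories

section Probability

variable {Ω : Type*} [MeasurableSpace Ω] {n r p m : ℕ}

/-- The experiment consists of random variables, with `‖u_t‖ ≤ C_u` a.s. for `t ≥ 1`. -/
structure Admissible (P : Measure Ω) (Cu : ℝ) (e : Experiment Ω r p m) : Prop where
  measurable_init : Measurable e.init
  measurable_input : ∀ t, Measurable (e.input t)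
  bounded : ∀ t, 1 ≤ t → ∀ᵐ ω ∂P, ‖e.input t ω‖ ≤ Cu

/-- `{w_t}_{t ≥ 1}` is i.i.d., bounded by `C_w`, and its common law charges the balls of any fixed
radius with centre in the closed ball of radius `C_w` uniformly. -/
structure Noise (P : Measure Ω) (Cw : ℝ) (w : ℕ → Ω → Vec p) : Prop where
  measurable : ∀ t, 1 ≤ t → Measurable (w t)
  indep : iIndepFun (fun t : ℕ => w (t + 1)) P
  identDistrib : ∀ t, 1 ≤ t → IdentDistrib (w t) (w 1) P P
  bounded : ∀ᵐ ω ∂P, ‖w 1 ω‖ ≤ Cw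
  charges : ∀ δ : ℝ, 0 < δ →
    0 < ⨅ z ∈ Metric.closedBall (0 : Vec p) Cw, P (w 1 ⁻¹' Metric.ball z δ)

/-- For each `t ≥ 1`, the noise `w_t` is independent of the past. -/
def IndepOfPast (P : Measure Ω) (e : Experiment Ω r p m) (w : ℕ → Ω → Vec p) : Prop :=
  ∀ t, 1 ≤ t → Indep (MeasurableSpace.comap (w t) inferInstance) (past e w t) P

/-- `P{‖φ_t‖ ≤ C i.o.} = 1`. -/
def Recurrent (P : Measure Ω) (f : Vec n → Regressor p m → Vec p)
    (f' : Vec r → Regressor p m → Vec p) (θ : Vec n) (e : Experiment Ω r p m)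
    (w : ℕ → Ω → Vec p) (C : ℝ) : Prop :=
  ∀ᵐ ω ∂P, ∃ᶠ t in atTop, ‖phi f f' θ e w t ω‖ ≤ C

/-- Almost surely, `‖φ_t‖ ≤ C` with `t ≥ 1` forces `‖f(θ, φ_i) + f'(u_i, φ_i)‖ ≤ C₀` for
`i = t, …, t + m - 1`. -/
def DriftBound (P : Measure Ω) (f : Vec n → Regressor p m → Vec p)
    (f' : Vec r → Regressor p m → Vec p) (θ : Vec n) (e : Experiment Ω r p m)
    (w : ℕ → Ω → Vec p) (C C₀ : ℝ) : Prop :=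
  ∀ᵐ ω ∂P, ∀ t, 1 ≤ t → ‖phi f f' θ e w t ω‖ ≤ C →
    ∀ i, t ≤ i → i < t + m → ‖drift f f' θ e w i ω‖ ≤ C₀

/-- Identifiability: one estimator, i.e. one sequence of measurable functions of the data
`(y_1, u_0), …, (y_t, u_{t-1})`, recovers almost surely in the limit whichever `θ ∈ Θ` is the
true parameter. As inputs may be generated by feedback, the experiment that is carried out may
depend on the true parameter: `e θ` is its realization when this parameter is `θ`. The estimator
does not see `θ`, `φ_0` or the noise. -/
def Identifiable (P : Measure Ω) (Θ : Set (Vec n)) (f : Vec n → Regressor p m → Vec p)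
    (f' : Vec r → Regressor p m → Vec p) (e : Vec n → Experiment Ω r p m)
    (w : ℕ → Ω → Vec p) : Prop :=
  ∃ est : (t : ℕ) → (Fin t → Vec p × Vec r) → Vec n,
    (∀ t, Measurable (est t)) ∧
    ∀ θ ∈ Θ, ∀ᵐ ω ∂P,
      Tendsto (fun t => est t (data f f' θ (e θ) w t ω)) atTop (𝓝 θ)

end Probability

/-- The hyperrectangle `∏ [a_i, b_i]` in `ℝ^n`. -/
def hyperrectangle {n : ℕ} (a b : Fin n → ℝ) : Set (Vec n) :=
  {x | ∀ i, a i ≤ x i ∧ x i ≤ b i}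

/-- The points at which the parameters `x` and `x'` give different values of `f`. -/
def excitationSet {n p m : ℕ} (f : Vec n → Regressor p m → Vec p) (x x' : Vec n) :
    Set (Regressor p m) :=
  {β | f x β ≠ f x' β}

/-- The lower density `1 / sup_{z ∈ Z} inf {d > 0 : B(z, d) ∩ Z' ≠ ∅}` of `Z'` in `Z`, with
values in `[0, ∞]`. -/
def lowerDensity {l : ℕ} (Z' Z : Set (Vec l)) : ℝ≥0∞ :=
  (⨆ z ∈ Z, ⨅ (d : ℝ) (_ : 0 < d ∧ (Metric.ball z d ∩ Z').Nonempty), ENNReal.ofReal d)⁻¹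

/-- The `m`-symmetric lower density of `Z'` in `∏ Z_j`: the supremum, over all products
`∏ E_j ⊆ Z'`, of the least of the lower densities of `E_j` in `Z_j`. -/
def symLowerDensity {l m : ℕ} (Z' : Set (Regressor l m)) (Z : Fin m → Set (Vec l)) : ℝ≥0∞ :=
  ⨆ (E : Fin m → Set (Vec l)) (_ : {η : Regressor l m | ∀ j, η j ∈ E j} ⊆ Z'),
    ⨅ j, lowerDensity (E j) (Z j)

end ControlSystem

end

/-!
Let `v = f(θ, φ) - f(x, φ)`. If the parameter is `θ`, the prediction error for `x` at a time with
regressor `φ` is `w + v`, where `w` is the noise. A noise value near `C_w v / ‖v‖` makes it longer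
than `C_w`, which never happens for `x = θ`; so `x` gets refuted if `φ_t` returns infinitely often
to a region where `v` is bounded away from `0`.

The density condition supplies such a region around a finite product `∏ F_j` on which
`f(θ, ·) ≠ f(x, ·)`: after a visit of `φ_t` to the ball of radius `C` the drift stays in the ball
of radius `C₀`, so a point of `F_j` is always less than `C_w` away, and the noise can steer each of
the next `m` outputs there. Since the noise is independent of the past and charges all balls centred
in the ball of radius `C_w`, it does so infinitely often, by Lévy's conditional Borel–Cantelli
lemma. Refutation extends to a neighbourhood of `x`, so countably many such `x` suffice, and by
compactness any sequence of parameters with vanishing total excess of prediction errors converges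
to `θ`.
-/

noncomputable section

namespace ControlSystem

section BorelCantelli

variable {Ω : Type*} {m0 : MeasurableSpace Ω} {P : Measure Ω} [IsFiniteMeasure P]

theorem condExp_indicator_inter_of_indep {m₁ m₂ : MeasurableSpace Ω} (hm₁ : m₁ ≤ m0)
    (hm₂ : m₂ ≤ m0) (hind : Indep m₁ m₂ P) {A H : Set Ω} (hA : MeasurableSet[m₁] A)
    (hH : MeasurableSet[m₂] H) :
    P[(H ∩ A).indicator (1 : Ω → ℝ) | m₂] =ᵐ[P] H.indicator fun _ => P.real A := by
  have hout : P[H.indicator (A.indicator (1 : Ω → ℝ)) | m₂] =ᵐ[P]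
      H.indicator (P[A.indicator (1 : Ω → ℝ) | m₂]) :=
    condExp_indicator ((integrable_const (1 : ℝ)).indicator (hm₁ _ hA)) hH
  have hconst : P[A.indicator (1 : Ω → ℝ) | m₂] =ᵐ[P] fun _ => ∫ ω, A.indicator 1 ω ∂P :=
    condExp_indep_eq hm₁ hm₂ ((stronglyMeasurable_const (b := (1 : ℝ))).indicator hA) hind
  rw [integral_indicator_one (hm₁ _ hA)] at hconst
  rw [← Set.indicator_indicator]
  filter_upwards [hout, hconst] with ω hω hωA
  rw [hω]
  by_cases hωH : ω ∈ H <;> simp [hωH, hωA]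

theorem tendsto_sum_range_atTop_of_frequently_le {u : ℕ → ℝ} (hu : ∀ k, 0 ≤ u k) {c : ℝ}
    (hc : 0 < c) (h : ∃ᶠ k in atTop, c ≤ u k) :
    Tendsto (fun n => ∑ k ∈ Finset.range n, u k) atTop atTop := by
  refine (not_summable_iff_tendsto_nat_atTop_of_nonneg hu).1 fun hsum => h ?_
  filter_upwards [hsum.tendsto_atTop_zero.eventually_lt_const hc] with k hk using hk.not_ge

theorem ae_frequently_mem_inter_of_indep (ℱ : Filtration ℕ m0) {𝒢 : ℕ → MeasurableSpace Ω}
    (h𝒢 : ∀ k, 𝒢 k ≤ ℱ (k + 1)) (hind : ∀ k, Indep (𝒢 k) (ℱ k) P) {H A : ℕ → Set Ω}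
    (hH : ∀ k, MeasurableSet[ℱ k] (H k)) (hA : ∀ k, MeasurableSet[𝒢 k] (A k)) {c : ℝ}
    (hc : 0 < c) (hcA : ∀ k, c ≤ P.real (A k)) :
    ∀ᵐ ω ∂P, (∃ᶠ k in atTop, ω ∈ H k) → ∃ᶠ k in atTop, ω ∈ H k ∩ A k := by
  -- `H k ∩ A k` is known at time `k + 1` only, whence the shift.
  let s : ℕ → Set Ω := fun k => Nat.casesOn k ∅ fun k => H k ∩ A k
  have hs : ∀ k, MeasurableSet[ℱ k] (s k) := by
    rintro (_ | k)
    · exact @MeasurableSet.empty _ (ℱ 0)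
    · exact (ℱ.mono k.le_succ _ (hH k)).inter (h𝒢 k _ (hA k))
  have hcond : ∀ k, P[(s (k + 1)).indicator (1 : Ω → ℝ) | ℱ k] =ᵐ[P]
      (H k).indicator fun _ => P.real (A k) := fun k =>
    condExp_indicator_inter_of_indep ((h𝒢 k).trans (ℱ.le _)) (ℱ.le k) (hind k) (hA k) (hH k)
  filter_upwards [ae_mem_limsup_atTop_iff P hs, ae_all_iff.2 hcond] with ω hiff hωcond hfreq
  have hdiv : Tendsto (fun n => ∑ k ∈ Finset.range n,
      (H k).indicator (fun _ => P.real (A k)) ω) atTop atTop := by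
    refine tendsto_sum_range_atTop_of_frequently_le
      (fun k => Set.indicator_nonneg (fun _ _ => measureReal_nonneg) _) hc
      (hfreq.mono fun k hk => ?_)
    rw [Set.indicator_of_mem hk]
    exact hcA k
  have hlim : ω ∈ limsup s atTop := by
    rw [hiff]
    simpa only [hωcond] using hdiv
  rw [← limsup_nat_add s 1] at hlim
  exact mem_limsup_iff_frequently_mem.1 hlim

end BorelCantelli

section Topology

theorem exists_measurable_mem_of_isOpen {X D : Type*} [TopologicalSpace X] [MeasurableSpace X]
    [MeasurableSpace D] {K : Set X} [TopologicalSpace.SeparableSpace K] (hK : K.Nonempty)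
    {s : D → Set X} (hopen : ∀ d, IsOpen (s d)) (hmeas : ∀ x ∈ K, MeasurableSet {d | x ∈ s d}) :
    ∃ g : D → X, Measurable g ∧ ∀ d, g d ∈ K ∧ ((K ∩ s d).Nonempty → g d ∈ s d) := by
  classical
  have : Nonempty K := hK.to_subtype
  let x : ℕ → K := TopologicalSpace.denseSeq K
  let q : ℕ → D → Prop := fun k d => (x k : X) ∈ s d ∨ ∀ j, (x j : X) ∉ s d
  have hq : ∀ d, ∃ k, q k d := fun d => by
    by_cases h : ∃ k, (x k : X) ∈ s d
    · exact h.imp fun k => Or.inl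
    · exact ⟨0, Or.inr (not_exists.1 h)⟩
  have hqmeas : ∀ k, MeasurableSet {d | q k d} := fun k => by
    refine (hmeas _ (x k).2).union (s₂ := {d | ∀ j, (x j : X) ∉ s d}) ?_
    rw [Set.ofPred_forall]
    exact MeasurableSet.iInter fun j => (hmeas _ (x j).2).compl
  refine ⟨fun d => x (Nat.find (hq d)),
    Measurable.find (f := fun k _ => (x k : X)) (fun _ => measurable_const) hqmeas hq,
    fun d => ⟨Subtype.prop _, ?_⟩⟩
  rintro ⟨z, hzK, hzs⟩
  obtain ⟨k, hk⟩ := (TopologicalSpace.denseRange_denseSeq K).exists_mem_open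
    ((hopen d).preimage continuous_subtype_val) ⟨⟨z, hzK⟩, hzs⟩
  exact (Nat.find_spec (hq d)).resolve_right fun h => h k hk

theorem tendsto_of_monotone_of_tendsto_zero {ι X : Type*} [Preorder ι] [TopologicalSpace X]
    {K : Set X} (hK : IsCompact K) {L : ι → X → ℝ} (hL : ∀ t, LowerSemicontinuous (L t))
    (hmono : Monotone L) {θ : X} (hpos : ∀ z ∈ K, z ≠ θ → ∃ t, 0 < L t z) {x : ι → X}
    (hxK : ∀ t, x t ∈ K) (hx : Tendsto (fun t => L t (x t)) atTop (𝓝 0)) :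
    Tendsto x atTop (𝓝 θ) := by
  refine hK.tendsto_nhds_of_unique_mapClusterPt (Eventually.of_forall hxK) fun z hzK hz => ?_
  by_contra hzθ
  obtain ⟨T, hT⟩ := hpos z hzK hzθ
  have hnear : ∃ᶠ t in atTop, L T z / 2 < L T (x t) :=
    hz.frequently (hL T z _ (half_lt_self hT))
  obtain ⟨t, hlow, hTt, hsmall⟩ := (hnear.and_eventually
    ((eventually_ge_atTop T).and (hx.eventually_lt_const (half_pos hT)))).exists
  exact (hlow.trans_le (hmono hTt (x t))).not_gt hsmall

theorem exists_finite_subset_thickening {X : Type*} [PseudoMetricSpace X] {Z E : Set X}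
    (hZ : IsCompact Z) {c : ℝ} (h : Z ⊆ Metric.thickening c E) :
    ∃ F ⊆ E, F.Finite ∧ Z ⊆ Metric.thickening c F := by
  simp only [Metric.thickening_eq_biUnion_ball] at h ⊢
  exact hZ.elim_finite_subcover_image (fun _ _ => Metric.isOpen_ball) h

theorem exists_pos_forall_mem_thickening_imp_mem {ι : Type*} [Finite ι] {X : ι → Type*}
    [∀ i, PseudoMetricSpace (X i)] {F : ∀ i, Set (X i)} (hF : ∀ i, IsCompact (F i))
    {V : Set (∀ i, X i)} (hV : IsOpen V) (hFV : Set.univ.pi F ⊆ V) :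
    ∃ δ > 0, ∀ y : ∀ i, X i, (∀ i, y i ∈ Metric.thickening δ (F i)) → y ∈ V := by
  have := Fintype.ofFinite ι
  obtain ⟨δ, hδ, hδV⟩ := (isCompact_univ_pi hF).exists_thickening_subset_open hV hFV
  refine ⟨δ, hδ, fun y hy => hδV ?_⟩
  choose z hzF hyz using fun i => Metric.mem_thickening_iff.1 (hy i)
  exact Metric.mem_thickening_iff.2 ⟨z, fun i _ => hzF i, (dist_pi_lt_iff hδ).2 hyz⟩

theorem exists_nhds_forall_add_norm_sub_lt {X Y V : Type*} [TopologicalSpace X]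
    [TopologicalSpace Y] [SeminormedAddCommGroup V] {g : X → Y → V}
    (hg : Continuous (Function.uncurry g)) {θ x : X} {G : Set Y} (hG : IsCompact G)
    (hpos : ∀ y ∈ G, 0 < ‖g θ y - g x y‖) :
    ∃ U ∈ 𝓝 x, ∃ W, IsOpen W ∧ G ⊆ W ∧ ∃ ε > 0, ∀ x' ∈ U, ∀ y ∈ W,
      ε + ‖g x y - g x' y‖ < ‖g θ y - g x y‖ := by
  let gap : X × Y → ℝ := fun z => ‖g θ z.2 - g x z.2‖ - ‖g x z.2 - g z.1 z.2‖
  have hgap : Continuous gap := by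
    have hy : ∀ x₀, Continuous fun z : X × Y => g x₀ z.2 := fun x₀ =>
      hg.comp₂ continuous_const continuous_snd
    exact ((hy θ).sub (hy x)).norm.sub ((hy x).sub hg).norm
  have hcpt : IsCompact ({x} ×ˢ G) := isCompact_singleton.prod hG
  obtain ⟨c, hc, hcgap⟩ := hcpt.exists_forall_le' hgap.continuousOn (a := 0) <| by
    rintro ⟨_, y⟩ ⟨rfl, hy⟩
    simpa [gap] using hpos y hy
  obtain ⟨U, W, hU, hW, hxU, hGW, hUW⟩ := generalized_tube_lemma isCompact_singleton hG
    (isOpen_lt continuous_const hgap) fun z hz => (half_lt_self hc).trans_le (hcgap z hz)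
  refine ⟨U, hU.mem_nhds (hxU rfl), W, hW, hGW, c / 2, half_pos hc, fun x' hx' y hy => ?_⟩
  exact lt_sub_iff_add_lt.1 (hUW (Set.mk_mem_prod hx' hy))

theorem lt_norm_add_of_dist_smul_lt {V : Type*} [SeminormedAddCommGroup V] [NormedSpace ℝ V]
    {c ε : ℝ} (hc : 0 ≤ c) {v v' y : V} (hy : dist y ((c / ‖v‖) • v) < ε)
    (hv : ε + ‖v' - v‖ ≤ ‖v‖) : c < ‖y + v'‖ := by
  have hv0 : 0 < ‖v‖ := by linarith [dist_nonneg.trans_lt hy, norm_nonneg (v' - v)]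
  have hextreme : ‖(c / ‖v‖) • v + v‖ = c + ‖v‖ := by
    rw [show (c / ‖v‖) • v + v = (c / ‖v‖ + 1) • v by rw [add_smul, one_smul], norm_smul,
      Real.norm_of_nonneg (by positivity)]
    field_simp
  have htri : c + ‖v‖ ≤ ‖y + v'‖ + dist ((c / ‖v‖) • v + v) (y + v') := by
    rw [← hextreme, dist_eq_norm]
    exact norm_le_norm_add_norm_sub' _ _
  have hdist := dist_add_add_le ((c / ‖v‖) • v) v y v'
  rw [dist_comm _ y, dist_comm v, dist_eq_norm v'] at hdist
  linarith

end Topology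

section Density

variable {l m : ℕ} {c : ℝ}

theorem subset_thickening_of_lt_lowerDensity {Z' Z : Set (Vec l)}
    (h : (ENNReal.ofReal c)⁻¹ < lowerDensity Z' Z) : Z ⊆ Metric.thickening c Z' := by
  intro z hz
  rw [lowerDensity, ENNReal.inv_lt_inv] at h
  have hinf : ⨅ (d : ℝ) (_ : 0 < d ∧ (Metric.ball z d ∩ Z').Nonempty), ENNReal.ofReal d <
      ENNReal.ofReal c := (le_iSup₂ (f := fun z (_ : z ∈ Z) =>
        ⨅ (d : ℝ) (_ : 0 < d ∧ (Metric.ball z d ∩ Z').Nonempty), ENNReal.ofReal d) z hz).trans_lt h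
  simp only [iInf_lt_iff] at hinf
  obtain ⟨d, ⟨_, η, hηd, hηZ'⟩, hdc⟩ := hinf
  exact Metric.mem_thickening_iff.2
    ⟨η, hηZ', (Metric.mem_ball'.1 hηd).trans (ENNReal.ofReal_lt_ofReal_iff'.1 hdc).1⟩

theorem exists_finite_pi_subset_of_lt_symLowerDensity {Z' : Set (Regressor l m)}
    {Z : Fin m → Set (Vec l)} (hZ : ∀ j, IsCompact (Z j))
    (h : (ENNReal.ofReal c)⁻¹ < symLowerDensity Z' Z) :
    ∃ F : Fin m → Set (Vec l), (∀ j, (F j).Finite) ∧ {η : Regressor l m | ∀ j, η j ∈ F j} ⊆ Z' ∧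
      ∀ j, Z j ⊆ Metric.thickening c (F j) := by
  simp only [symLowerDensity, lt_iSup_iff] at h
  obtain ⟨E, hEZ', hE⟩ := h
  choose F hFE hFfin hZF using fun j => exists_finite_subset_thickening (hZ j)
    (subset_thickening_of_lt_lowerDensity (hE.trans_le (iInf_le _ j)))
  exact ⟨F, hFfin, fun η hη => hEZ' fun j => hFE j (hη j), hZF⟩

end Density

section Trajectories

variable {Ω : Type*} {n r p m : ℕ} {f : Vec n → Regressor p m → Vec p}
  {f' : Vec r → Regressor p m → Vec p} {θ : Vec n} {e : Experiment Ω r p m} {w : ℕ → Ω → Vec p}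

/-- The output `y_{t+1}` (indexed, like `drift`, by the time `t` of the regressor producing it). -/
def nextOutput (f : Vec n → Regressor p m → Vec p) (f' : Vec r → Regressor p m → Vec p)
    (θ : Vec n) (e : Experiment Ω r p m) (w : ℕ → Ω → Vec p) (t : ℕ) (ω : Ω) : Vec p :=
  drift f f' θ e w t ω + w (t + 1) ω

/-- The one-step prediction error `y_{t+1} - f(x, φ_t) - f'(u_t, φ_t)` for the parameter `x` when
the true parameter is `θ`. -/
def predictionError (f : Vec n → Regressor p m → Vec p) (f' : Vec r → Regressor p m → Vec p)
    (θ : Vec n) (e : Experiment Ω r p m) (w : ℕ → Ω → Vec p) (x : Vec n) (t : ℕ) (ω : Ω) :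
    Vec p :=
  nextOutput f f' θ e w t ω - f x (phi f f' θ e w t ω) -
    f' (e.input t ω) (phi f f' θ e w t ω)

theorem predictionError_eq (x : Vec n) (t : ℕ) (ω : Ω) :
    predictionError f f' θ e w x t ω =
      w (t + 1) ω + (f θ (phi f f' θ e w t ω) - f x (phi f f' θ e w t ω)) := by
  simp only [predictionError, nextOutput, drift]
  abel

theorem phi_succ (t : ℕ) (ω : Ω) :
    phi f f' θ e w (t + 1) ω = push (nextOutput f f' θ e w t ω) (phi f f' θ e w t ω) := rfl

theorem phi_add (t k : ℕ) (ω : Ω) :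
    phi f f' θ e w (t + k) ω = regressor f f' θ (phi f f' θ e w t ω)
      (fun s => e.input (t + s) ω) (fun s => w (t + s) ω) k := by
  induction k with
  | zero => rfl
  | succ k ih =>
    rw [← add_assoc, phi_succ, regressor, ← ih]
    rfl

theorem phi_apply {t : ℕ} (j : Fin m) (hj : (j : ℕ) < t) (ω : Ω) :
    phi f f' θ e w t ω j = nextOutput f f' θ e w (t - 1 - j) ω := by
  induction t generalizing j with
  | zero => omega
  | succ t ih =>
    rw [phi_succ]
    rcases Nat.eq_zero_or_pos (j : ℕ) with h0 | hpos
    · simp [push, h0]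
    · have hprev := ih ⟨j - 1, by omega⟩ (by simp only; omega)
      have hidx : t - 1 - ((j : ℕ) - 1) = t + 1 - 1 - j := by omega
      simpa [push, hpos.ne', hidx] using hprev

theorem continuous_push :
    Continuous fun z : Vec p × Regressor p m => push z.1 z.2 := by
  refine (PiLp.continuous_toLp 2 _).comp (continuous_pi fun j => ?_)
  split_ifs <;> fun_prop

theorem continuous_regressor (hf : Continuous (Function.uncurry f))
    (hf' : Continuous (Function.uncurry f')) (t : ℕ) :
    Continuous fun z : Vec n × Regressor p m × (ℕ → Vec r) × (ℕ → Vec p) =>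
      regressor f f' z.1 z.2.1 z.2.2.1 z.2.2.2 t := by
  induction t with
  | zero => exact continuous_snd.fst
  | succ t ih =>
    have houtput := ((hf.comp₂ continuous_fst ih).add (hf'.comp₂
      (e := fun z : Vec n × Regressor p m × (ℕ → Vec r) × (ℕ → Vec p) => z.2.2.1 t)
      (by fun_prop) ih)).add (by fun_prop : Continuous fun z :
        Vec n × Regressor p m × (ℕ → Vec r) × (ℕ → Vec p) => z.2.2.2 (t + 1))
    exact continuous_push.comp₂ houtput ih

theorem exists_pos_forall_norm_drift_le {Θ : Set (Vec n)} (hΘ : IsCompact Θ)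
    (hf : Continuous (Function.uncurry f)) (hf' : Continuous (Function.uncurry f'))
    (Cu Cw C : ℝ) :
    ∃ C₀ : ℝ, 0 < C₀ ∧ ∀ θ ∈ Θ, ∀ (e : Experiment Ω r p m) (w : ℕ → Ω → Vec p) (ω : Ω),
      (∀ t, 1 ≤ t → ‖e.input t ω‖ ≤ Cu) → (∀ t, 1 ≤ t → ‖w t ω‖ ≤ Cw) →
      ∀ t, 1 ≤ t → ‖phi f f' θ e w t ω‖ ≤ C →
        ∀ i, t ≤ i → i < t + m → ‖drift f f' θ e w i ω‖ ≤ C₀ := by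
  let drifts : Vec n × Regressor p m × (ℕ → Vec r) × (ℕ → Vec p) → Fin m → Vec p := fun z k =>
    f z.1 (regressor f f' z.1 z.2.1 z.2.2.1 z.2.2.2 k) +
      f' (z.2.2.1 k) (regressor f f' z.1 z.2.1 z.2.2.1 z.2.2.2 k)
  have hdrifts : Continuous drifts := continuous_pi fun k =>
    (hf.comp₂ continuous_fst (continuous_regressor hf hf' k)).add
      (hf'.comp₂ (by fun_prop) (continuous_regressor hf hf' k))
  have hcpt : IsCompact (Θ ×ˢ Metric.closedBall (0 : Regressor p m) C ×ˢ
      (Set.univ.pi fun _ : ℕ => Metric.closedBall (0 : Vec r) Cu) ×ˢ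
      (Set.univ.pi fun _ : ℕ => Metric.closedBall (0 : Vec p) Cw)) :=
    hΘ.prod ((isCompact_closedBall _ _).prod
      ((isCompact_univ_pi fun _ => isCompact_closedBall _ _).prod
        (isCompact_univ_pi fun _ => isCompact_closedBall _ _)))
  obtain ⟨M, hM⟩ := hcpt.exists_bound_of_continuousOn hdrifts.continuousOn
  refine ⟨max M 1, by positivity, fun θ hθ e w ω hu hw t ht hφ i hti hit => ?_⟩
  obtain ⟨k, rfl⟩ := Nat.exists_eq_add_of_le hti
  have hbound := hM (θ, phi f f' θ e w t ω, fun s => e.input (t + s) ω, fun s => w (t + s) ω)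
    ⟨hθ, by simpa using hφ, fun s _ => by simpa using hu (t + s) (by omega),
      fun s _ => by simpa using hw (t + s) (by omega)⟩
  have hdrift : drift f f' θ e w (t + k) ω = drifts (θ, phi f f' θ e w t ω,
      fun s => e.input (t + s) ω, fun s => w (t + s) ω) ⟨k, by omega⟩ := by
    simp only [drift, drifts, phi_add]
  rw [hdrift]
  exact (norm_le_pi_norm _ _).trans (hbound.trans (le_max_left _ _))

end Trajectories

section Past

variable {Ω : Type*} {n r p m : ℕ} {f : Vec n → Regressor p m → Vec p}
  {f' : Vec r → Regressor p m → Vec p} {θ : Vec n} {e : Experiment Ω r p m} {w : ℕ → Ω → Vec p}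
  {s t : ℕ}

theorem past_mono (e : Experiment Ω r p m) (w : ℕ → Ω → Vec p) : Monotone (past e w) := by
  intro s t hst
  refine sup_le_sup (sup_le_sup le_rfl ?_) ?_
  · exact iSup_mono fun i => iSup_mono' fun h => ⟨h.trans_le hst, le_rfl⟩
  · exact iSup_mono fun i => iSup_mono' fun h => ⟨⟨h.1, h.2.trans_le hst⟩, le_rfl⟩

theorem past_le [m0 : MeasurableSpace Ω] (hinit : Measurable e.init)
    (hinput : ∀ t, Measurable (e.input t)) (hw : ∀ t, 1 ≤ t → Measurable (w t)) (t : ℕ) :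
    past e w t ≤ m0 :=
  sup_le (sup_le hinit.comap_le (iSup₂_le fun i _ => (hinput i).comap_le))
    (iSup₂_le fun i hi => (hw i hi.1).comap_le)

theorem measurable_init_past (t : ℕ) : Measurable[past e w t] e.init :=
  measurable_iff_comap_le.2 (le_sup_left.trans le_sup_left)

theorem measurable_input_past (hst : s < t) : Measurable[past e w t] (e.input s) :=
  measurable_iff_comap_le.2 <|
    (le_iSup₂ (f := fun i (_ : i < t) => MeasurableSpace.comap (e.input i) inferInstance) s
      hst).trans (le_sup_right.trans le_sup_left)

theorem measurable_noise_past (hs : 1 ≤ s) (hst : s < t) : Measurable[past e w t] (w s) :=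
  measurable_iff_comap_le.2 <|
    (le_iSup₂ (f := fun i (_ : 1 ≤ i ∧ i < t) => MeasurableSpace.comap (w i) inferInstance) s
      ⟨hs, hst⟩).trans le_sup_right

theorem measurable_drift_of_measurable_phi {_ : MeasurableSpace Ω}
    (hf : Continuous (Function.uncurry f)) (hf' : Continuous (Function.uncurry f'))
    (hφ : Measurable (phi f f' θ e w t)) (hu : Measurable (e.input t)) :
    Measurable (drift f f' θ e w t) :=
  (hf.measurable.comp (measurable_const.prodMk hφ)).add (hf'.measurable.comp (hu.prodMk hφ))

theorem measurable_phi_past (hf : Continuous (Function.uncurry f))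
    (hf' : Continuous (Function.uncurry f')) (hst : s < t) :
    Measurable[past e w t] (phi f f' θ e w s) := by
  induction s with
  | zero => exact measurable_init_past t
  | succ s ih =>
    have hφ := ih (by omega)
    have hdrift := measurable_drift_of_measurable_phi hf hf' hφ (measurable_input_past (by omega))
    exact continuous_push.measurable.comp
      ((hdrift.add (measurable_noise_past (by omega) hst)).prodMk hφ)

theorem measurable_drift_past (hf : Continuous (Function.uncurry f))
    (hf' : Continuous (Function.uncurry f')) (hst : s < t) :
    Measurable[past e w t] (drift f f' θ e w s) :=
  measurable_drift_of_measurable_phi hf hf' (measurable_phi_past hf hf' hst)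
    (measurable_input_past hst)

theorem measurable_nextOutput_past (hf : Continuous (Function.uncurry f))
    (hf' : Continuous (Function.uncurry f')) (hst : s + 1 < t) :
    Measurable[past e w t] (nextOutput f f' θ e w s) :=
  (measurable_drift_past hf hf' (by omega)).add (measurable_noise_past (by omega) hst)

end Past

section Noise

variable {Ω : Type*} [m0 : MeasurableSpace Ω] {P : Measure Ω} {n r p m : ℕ}
  {f : Vec n → Regressor p m → Vec p} {f' : Vec r → Regressor p m → Vec p} {θ : Vec n}
  {e : Experiment Ω r p m} {w : ℕ → Ω → Vec p} {Cw Cu C : ℝ}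

theorem Admissible.ae_norm_input_le (he : Admissible P Cu e) :
    ∀ᵐ ω ∂P, ∀ t, 1 ≤ t → ‖e.input t ω‖ ≤ Cu :=
  ae_all_iff.2 fun t => eventually_imp_distrib_left.2 (he.bounded t)

theorem Noise.ae_norm_le (hw : Noise P Cw w) : ∀ᵐ ω ∂P, ∀ t, 1 ≤ t → ‖w t ω‖ ≤ Cw :=
  ae_all_iff.2 fun t => eventually_imp_distrib_left.2 fun ht =>
    (hw.identDistrib t ht).symm.ae_snd (p := fun z => ‖z‖ ≤ Cw)
      (measurableSet_le measurable_norm measurable_const) hw.bounded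

theorem exists_pos_forall_driftBound {Θ : Set (Vec n)} (hΘ : IsCompact Θ)
    (hf : Continuous (Function.uncurry f)) (hf' : Continuous (Function.uncurry f'))
    (hw : Noise P Cw w) {e : Vec n → Experiment Ω r p m}
    (he : ∀ θ ∈ Θ, Admissible P Cu (e θ)) (C : ℝ) :
    ∃ C₀ : ℝ, 0 < C₀ ∧ ∀ θ ∈ Θ, DriftBound P f f' θ (e θ) w C C₀ := by
  obtain ⟨C₀, hC₀, hdrift⟩ := exists_pos_forall_norm_drift_le (Ω := Ω) hΘ hf hf' Cu Cw C
  refine ⟨C₀, hC₀, fun θ hθ => ?_⟩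
  filter_upwards [(he θ hθ).ae_norm_input_le, hw.ae_norm_le] with ω hωu hωw
  exact hdrift θ hθ (e θ) w ω hωu hωw

variable [IsProbabilityMeasure P]

theorem Noise.ae_frequently_mem_ball (hw : Noise P Cw w) (he : Admissible P Cu e)
    (hind : IndepOfPast P e w) (k : ℕ) {S : ℕ → Set Ω}
    (hS : ∀ t, MeasurableSet[past e w (t + k + 1)] (S t)) {q : Vec p}
    (hq : q ∈ Metric.closedBall (0 : Vec p) Cw) {δ : ℝ} (hδ : 0 < δ) :
    ∀ᵐ ω ∂P, (∃ᶠ t in atTop, ω ∈ S t) →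
      ∃ᶠ t in atTop, ω ∈ S t ∧ w (t + k + 1) ω ∈ Metric.ball q δ := by
  let ℱ : Filtration ℕ m0 :=
    { seq := fun t => past e w (t + k + 1)
      mono' := fun s t hst => past_mono e w (by omega)
      le' := fun t => past_le he.measurable_init he.measurable_input hw.measurable _ }
  have hpos : 0 < P (w 1 ⁻¹' Metric.ball q δ) := (hw.charges δ hδ).trans_le (iInf₂_le q hq)
  have hlaw : ∀ t, P.real (w 1 ⁻¹' Metric.ball q δ) =
      P.real (w (t + k + 1) ⁻¹' Metric.ball q δ) := fun t => by
    rw [measureReal_def, measureReal_def,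
      (hw.identDistrib (t + k + 1) (by omega)).measure_mem_eq measurableSet_ball]
  exact ae_frequently_mem_inter_of_indep ℱ
    (fun t => (measurable_noise_past (by omega) (by omega)).comap_le)
    (fun t => hind (t + k + 1) (by omega)) hS (fun t => ⟨_, measurableSet_ball, rfl⟩)
    (ENNReal.toReal_pos hpos.ne' (measure_ne_top _ _)) fun t => (hlaw t).le

theorem Noise.ae_frequently_dist_lt (hw : Noise P Cw w) (he : Admissible P Cu e)
    (hind : IndepOfPast P e w) (k : ℕ) {S : ℕ → Set Ω}
    (hS : ∀ t, MeasurableSet[past e w (t + k + 1)] (S t)) {X : ℕ → Ω → Vec p}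
    (hX : ∀ t, Measurable[past e w (t + k + 1)] (X t)) {δ : ℝ} (hδ : 0 < δ) :
    ∀ᵐ ω ∂P, (∃ᶠ t in atTop, ω ∈ S t ∧ ‖X t ω‖ ≤ Cw) →
      ∃ᶠ t in atTop, ω ∈ S t ∧ dist (w (t + k + 1) ω) (X t ω) < δ := by
  obtain ⟨Q, hQ, hQfin, hcover⟩ :=
    (isCompact_closedBall (0 : Vec p) Cw).finite_cover_balls (half_pos hδ)
  have hball : ∀ᵐ ω ∂P, ∀ q ∈ Q, (∃ᶠ t in atTop, ω ∈ S t ∩ X t ⁻¹' Metric.ball q (δ / 2)) →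
      ∃ᶠ t in atTop, ω ∈ S t ∩ X t ⁻¹' Metric.ball q (δ / 2) ∧
        w (t + k + 1) ω ∈ Metric.ball q (δ / 2) :=
    (ae_ball_iff hQfin.countable).2 fun q hq => hw.ae_frequently_mem_ball he hind k
      (fun t => (hS t).inter (hX t measurableSet_ball)) (hQ hq) (half_pos hδ)
  filter_upwards [hball] with ω hω hfreq
  have hnear : ∃ᶠ t in atTop, ∃ q ∈ Q, ω ∈ S t ∩ X t ⁻¹' Metric.ball q (δ / 2) :=
    hfreq.mono fun t ⟨hSt, hXt⟩ => by
      obtain ⟨q, hqQ, hq⟩ := Set.mem_iUnion₂.1 (hcover (mem_closedBall_zero_iff.2 hXt))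
      exact ⟨q, hqQ, hSt, hq⟩
  obtain ⟨q, hqQ, hq⟩ := hQfin.frequently_exists.1 hnear
  refine (hω q hqQ hq).mono fun t ⟨⟨hSt, hXt⟩, hwt⟩ => ⟨hSt, ?_⟩
  calc dist (w (t + k + 1) ω) (X t ω)
      ≤ dist (w (t + k + 1) ω) q + dist (X t ω) q := dist_triangle_right _ _ _
    _ < δ / 2 + δ / 2 := add_lt_add hwt hXt
    _ = δ := add_halves δ

theorem ae_frequently_nextOutput_mem_thickening (hf : Continuous (Function.uncurry f))
    (hf' : Continuous (Function.uncurry f')) (hw : Noise P Cw w) (he : Admissible P Cu e)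
    (hind : IndepOfPast P e w) (k : ℕ) {S : ℕ → Set Ω}
    (hS : ∀ t, MeasurableSet[past e w (t + k + 1)] (S t)) {F : Set (Vec p)} (hF : F.Finite)
    {δ : ℝ} (hδ : 0 < δ) :
    ∀ᵐ ω ∂P,
      (∃ᶠ t in atTop, ω ∈ S t ∧ drift f f' θ e w (t + k) ω ∈ Metric.thickening Cw F) →
      ∃ᶠ t in atTop, ω ∈ S t ∧ nextOutput f f' θ e w (t + k) ω ∈ Metric.thickening δ F := by
  have hsteer := (ae_ball_iff hF.countable).2 fun η _ => hw.ae_frequently_dist_lt he hind k hS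
    (X := fun t ω => η - drift f f' θ e w (t + k) ω)
    (fun t => (measurable_drift_past hf hf' (by omega)).const_sub η) hδ
  filter_upwards [hsteer] with ω hω hfreq
  have hreach : ∃ᶠ t in atTop, ∃ η ∈ F,
      ω ∈ S t ∧ ‖η - drift f f' θ e w (t + k) ω‖ ≤ Cw := hfreq.mono fun t ⟨hSt, ht⟩ => by
    obtain ⟨η, hηF, hη⟩ := Metric.mem_thickening_iff.1 ht
    rw [dist_comm, dist_eq_norm] at hη
    exact ⟨η, hηF, hSt, hη.le⟩
  obtain ⟨η, hηF, hη⟩ := hF.frequently_exists.1 hreach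
  refine (hω η hηF hη).mono fun t ⟨hSt, ht⟩ => ⟨hSt, Metric.mem_thickening_iff.2 ⟨η, hηF, ?_⟩⟩
  rwa [nextOutput, dist_eq_norm, add_comm, add_sub_assoc, ← neg_sub η, ← sub_eq_add_neg,
    ← dist_eq_norm]

end Noise

section Excursions

variable {Ω : Type*} {n r p m : ℕ}
  {f : Vec n → Regressor p m → Vec p} {f' : Vec r → Regressor p m → Vec p} {θ : Vec n}
  {e : Experiment Ω r p m} {w : ℕ → Ω → Vec p} {Cw Cu C C₀ δ : ℝ} {F : Fin m → Set (Vec p)}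

/-- The event that `‖φ_t‖ ≤ C` and that those among the next `k` outputs which still enter
`φ_{t+m}` come within `δ` of the sets `F j` prescribed for the coordinates of `φ_{t+m}`. As the
newest output comes first in a regressor, `y_{t+i+1}` is coordinate `i.rev` of `φ_{t+m}`. -/
def excursion (f : Vec n → Regressor p m → Vec p) (f' : Vec r → Regressor p m → Vec p)
    (θ : Vec n) (e : Experiment Ω r p m) (w : ℕ → Ω → Vec p) (C δ : ℝ) (F : Fin m → Set (Vec p))
    (k t : ℕ) : Set Ω :=
  {ω | ‖phi f f' θ e w t ω‖ ≤ C ∧ ∀ i : Fin m, (i : ℕ) < k →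
    nextOutput f f' θ e w (t + i) ω ∈ Metric.thickening δ (F i.rev)}

theorem measurableSet_excursion (hf : Continuous (Function.uncurry f))
    (hf' : Continuous (Function.uncurry f')) (k t : ℕ) :
    MeasurableSet[past e w (t + k + 1)] (excursion f f' θ e w C δ F k t) := by
  have hvisit : MeasurableSet[past e w (t + k + 1)] {ω | ‖phi f f' θ e w t ω‖ ≤ C} :=
    measurable_phi_past hf hf' (by omega) (measurableSet_le measurable_norm measurable_const)
  have hnext : MeasurableSet[past e w (t + k + 1)] (⋂ i : Fin m, ⋂ _ : (i : ℕ) < k,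
      nextOutput f f' θ e w (t + i) ⁻¹' Metric.thickening δ (F i.rev)) :=
    MeasurableSet.iInter fun i => MeasurableSet.iInter fun hi =>
      measurable_nextOutput_past hf hf' (by omega) Metric.isOpen_thickening.measurableSet
  convert hvisit.inter hnext
  ext ω
  simp [excursion]

theorem phi_apply_mem_thickening_of_mem_excursion {t : ℕ} {ω : Ω}
    (hω : ω ∈ excursion f f' θ e w C δ F m t) (j : Fin m) :
    phi f f' θ e w (t + m) ω j ∈ Metric.thickening δ (F j) := by
  have hj := hω.2 j.rev j.rev.isLt
  have hidx : t + m - 1 - (j : ℕ) = t + j.rev := by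
    rw [Fin.val_rev]
    omega
  rw [Fin.rev_rev] at hj
  rwa [phi_apply j (by omega), hidx]

variable [MeasurableSpace Ω] {P : Measure Ω} [IsProbabilityMeasure P]

theorem ae_frequently_mem_excursion (hf : Continuous (Function.uncurry f))
    (hf' : Continuous (Function.uncurry f')) (hw : Noise P Cw w) (he : Admissible P Cu e)
    (hind : IndepOfPast P e w) (hrec : Recurrent P f f' θ e w C)
    (hC₀ : DriftBound P f f' θ e w C C₀) (hF : ∀ j, (F j).Finite)
    (hFC₀ : ∀ j, Metric.closedBall 0 C₀ ⊆ Metric.thickening Cw (F j)) (hδ : 0 < δ) {k : ℕ}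
    (hk : k ≤ m) :
    ∀ᵐ ω ∂P, ∃ᶠ t in atTop, ω ∈ excursion f f' θ e w C δ F k t := by
  induction k with
  | zero => simpa [excursion, Recurrent] using hrec
  | succ k ih =>
    filter_upwards [ih (by omega), hC₀, ae_frequently_nextOutput_mem_thickening (θ := θ) hf hf' hw
      he hind k (measurableSet_excursion (F := F) hf hf' k) (hF (Fin.rev ⟨k, hk⟩)) hδ]
      with ω hωk hωC₀ hsteer
    have hdrift : ∃ᶠ t in atTop, ω ∈ excursion f f' θ e w C δ F k t ∧
        drift f f' θ e w (t + k) ω ∈ Metric.thickening Cw (F (Fin.rev ⟨k, hk⟩)) :=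
      (hωk.and_eventually (eventually_ge_atTop 1)).mono fun t ⟨ht, ht1⟩ => ⟨ht, hFC₀ _
        (mem_closedBall_zero_iff.2 (hωC₀ t ht1 ht.1 (t + k) (by omega) (by omega)))⟩
    refine (hsteer hdrift).mono fun t ⟨ht, hnext⟩ => ⟨ht.1, fun i hi => ?_⟩
    rcases Nat.lt_succ_iff_lt_or_eq.1 hi with hlt | rfl
    · exact ht.2 i hlt
    · exact hnext

theorem exists_nhds_forall_near_pi (hf : Continuous (Function.uncurry f)) {x : Vec n}
    (hF : ∀ j, IsCompact (F j)) (hFx : {η : Regressor p m | ∀ j, η j ∈ F j} ⊆ excitationSet f θ x) :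
    ∃ U ∈ 𝓝 x, ∃ δ > 0, ∃ ε > 0, ∀ x' ∈ U, ∀ φ : Regressor p m,
      (∀ j, φ j ∈ Metric.thickening δ (F j)) → ε + ‖f x φ - f x' φ‖ < ‖f θ φ - f x φ‖ := by
  have hg : Continuous (Function.uncurry fun (x : Vec n) (y : Fin m → Vec p) =>
      f x (WithLp.toLp 2 y)) :=
    hf.comp₂ continuous_fst ((PiLp.continuous_toLp 2 _).comp continuous_snd)
  obtain ⟨U, hU, W, hW, hFW, ε, hε, hsep⟩ := exists_nhds_forall_add_norm_sub_lt hg (θ := θ)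
    (isCompact_univ_pi hF) fun y hy => norm_sub_pos_iff.2 <|
      hFx (a := WithLp.toLp 2 y) fun j => hy j trivial
  obtain ⟨δ, hδ, hδW⟩ := exists_pos_forall_mem_thickening_imp_mem hF hW hFW
  exact ⟨U, hU, δ, hδ, ε, hε, fun x' hx' φ hφ => hsep x' hx' φ.ofLp (hδW _ hφ)⟩

theorem exists_nhds_ae_exists_lt_norm_predictionError (hf : Continuous (Function.uncurry f))
    (hf' : Continuous (Function.uncurry f')) (hCw : 0 < Cw) (hw : Noise P Cw w)
    (he : Admissible P Cu e) (hind : IndepOfPast P e w) (hrec : Recurrent P f f' θ e w C)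
    (hC₀ : DriftBound P f f' θ e w C C₀) {x : Vec n}
    (hx : ENNReal.ofReal (1 / Cw) < symLowerDensity (excitationSet f θ x)
      fun _ : Fin m => Metric.closedBall (0 : Vec p) C₀) :
    ∃ U ∈ 𝓝 x, ∀ᵐ ω ∂P, ∀ x' ∈ U, ∃ s, m ≤ s ∧ Cw < ‖predictionError f f' θ e w x' s ω‖ := by
  rw [one_div, ENNReal.ofReal_inv_of_pos hCw] at hx
  obtain ⟨F, hF, hFx, hFC₀⟩ :=
    exists_finite_pi_subset_of_lt_symLowerDensity (fun _ => isCompact_closedBall _ _) hx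
  obtain ⟨U, hU, δ, hδ, ε, hε, hsep⟩ :=
    exists_nhds_forall_near_pi hf (fun j => (hF j).isCompact) hFx
  refine ⟨U, hU, ?_⟩
  let v : Regressor p m → Vec p := fun φ => f θ φ - f x φ
  have hv : Measurable v := Continuous.measurable <|
    (hf.comp₂ continuous_const continuous_id).sub (hf.comp₂ continuous_const continuous_id)
  have hextreme := hw.ae_frequently_dist_lt he hind m
    (measurableSet_excursion (θ := θ) (C := C) (δ := δ) (F := F) hf hf' m)
    (X := fun t ω => (Cw / ‖v (phi f f' θ e w (t + m) ω)‖) • v (phi f f' θ e w (t + m) ω))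
    (fun t => ((hv.norm.const_div Cw).smul hv).comp (measurable_phi_past hf hf' (by omega))) hε
  filter_upwards [hextreme, ae_frequently_mem_excursion hf hf' hw he hind hrec hC₀ hF hFC₀ hδ
    le_rfl] with ω hω hexc x' hx'
  have hnorm : ∀ u : Vec p, ‖(Cw / ‖u‖) • u‖ ≤ Cw := fun u => by
    rw [norm_smul, norm_div, norm_norm, Real.norm_of_nonneg hCw.le, div_mul_comm]
    exact mul_le_of_le_one_left hCw.le (div_self_le_one _)
  obtain ⟨t, ht, hwt⟩ := (hω (hexc.mono fun t ht => ⟨ht, hnorm _⟩)).exists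
  refine ⟨t + m, by omega, ?_⟩
  rw [predictionError_eq]
  refine lt_norm_add_of_dist_smul_lt hCw.le hwt ?_
  rw [sub_sub_sub_cancel_left]
  exact (hsep x' hx' _ (phi_apply_mem_thickening_of_mem_excursion ht)).le

end Excursions

section Estimation

variable {Ω : Type*} {n r p m : ℕ} {f : Vec n → Regressor p m → Vec p}
  {f' : Vec r → Regressor p m → Vec p} {θ : Vec n} {e : Experiment Ω r p m} {w : ℕ → Ω → Vec p}

/-- The regressor `φ_s = (y_s, …, y_{s-m+1})` read off the data `(y_1, u_0), …, (y_t, u_{t-1})`.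
It is meaningful for `m ≤ s` only: before, `φ_s` involves `φ_0`, which the data do not show. -/
def dataRegressor {t : ℕ} (d : Fin t → Vec p × Vec r) (s : Fin t) : Regressor p m :=
  WithLp.toLp 2 fun j : Fin m => (d ⟨s - 1 - j, by omega⟩).1

/-- The total amount by which the norms of the prediction errors for `x`, computed from the data
`d`, exceed the noise bound `C_w`. The estimator makes it small. -/
def loss (f : Vec n → Regressor p m → Vec p) (f' : Vec r → Regressor p m → Vec p) (Cw : ℝ)
    {t : ℕ} (x : Vec n) (d : Fin t → Vec p × Vec r) : ℝ :=
  ∑ s : Fin t with m ≤ s.val,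
    max 0 (‖(d s).1 - f x (dataRegressor d s) - f' (d s).2 (dataRegressor d s)‖ - Cw)

theorem continuous_loss (hf : Continuous (Function.uncurry f))
    (hf' : Continuous (Function.uncurry f')) (Cw : ℝ) (t : ℕ) :
    Continuous fun z : Vec n × (Fin t → Vec p × Vec r) => loss f f' Cw z.1 z.2 := by
  have hreg : ∀ s, Continuous fun z : Vec n × (Fin t → Vec p × Vec r) =>
      (dataRegressor z.2 s : Regressor p m) := fun s =>
    (PiLp.continuous_toLp 2 _).comp (continuous_pi fun j => by fun_prop)
  refine continuous_finsetSum _ fun s _ => continuous_const.max (Continuous.sub ?_ (by fun_prop))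
  refine Continuous.norm (Continuous.sub (Continuous.sub (by fun_prop) ?_) ?_)
  · exact hf.comp₂ continuous_fst (hreg s)
  · exact hf'.comp₂ (by fun_prop) (hreg s)

theorem dataRegressor_data (ω : Ω) {t : ℕ} (s : Fin t) (hs : m ≤ s) :
    dataRegressor (data f f' θ e w t ω) s = phi f f' θ e w s ω := by
  ext1 j
  rw [phi_apply j (by omega)]
  rfl

theorem loss_data (Cw : ℝ) (x : Vec n) (t : ℕ) (ω : Ω) :
    loss f f' Cw x (data f f' θ e w t ω) =
      ∑ s ∈ Finset.range t with m ≤ s, max 0 (‖predictionError f f' θ e w x s ω‖ - Cw) := by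
  rw [Finset.sum_filter, ← Fin.sum_univ_eq_sum_range (fun s => if m ≤ s then
    max 0 (‖predictionError f f' θ e w x s ω‖ - Cw) else 0), ← Finset.sum_filter]
  refine Finset.sum_congr rfl fun s hs => ?_
  rw [dataRegressor_data ω s (Finset.mem_filter.1 hs).2]
  rfl

theorem loss_data_mono (Cw : ℝ) (ω : Ω) :
    Monotone fun t x => loss f f' Cw x (data f f' θ e w t ω) := fun s t hst x => by
  simp only [loss_data]
  exact Finset.sum_le_sum_of_subset_of_nonneg
    (Finset.filter_subset_filter _ (Finset.range_mono hst)) fun _ _ _ => le_max_left _ _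

theorem loss_nonneg (Cw : ℝ) {t : ℕ} (x : Vec n) (d : Fin t → Vec p × Vec r) :
    0 ≤ loss f f' Cw x d :=
  Finset.sum_nonneg fun _ _ => le_max_left _ _

theorem loss_data_self {Cw : ℝ} {ω : Ω} (hω : ∀ t, 1 ≤ t → ‖w t ω‖ ≤ Cw) (t : ℕ) :
    loss f f' Cw θ (data f f' θ e w t ω) = 0 := by
  rw [loss_data]
  refine Finset.sum_eq_zero fun s _ => max_eq_left (sub_nonpos.2 ?_)
  simpa [predictionError_eq] using hω (s + 1) (by omega)

theorem loss_data_pos {Cw : ℝ} {x : Vec n} {s : ℕ} {ω : Ω} (hs : m ≤ s)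
    (hlt : Cw < ‖predictionError f f' θ e w x s ω‖) :
    0 < loss f f' Cw x (data f f' θ e w (s + 1) ω) := by
  rw [loss_data]
  exact Finset.sum_pos' (fun _ _ => le_max_left _ _)
    ⟨s, by simp [hs], lt_max_of_lt_right (sub_pos.2 hlt)⟩

theorem identifiable_of_ae_exists_lt_norm_predictionError [MeasurableSpace Ω] {P : Measure Ω}
    {Θ : Set (Vec n)} (hΘ : IsCompact Θ) (hf : Continuous (Function.uncurry f))
    (hf' : Continuous (Function.uncurry f')) {e : Vec n → Experiment Ω r p m} {Cw : ℝ}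
    (hw : ∀ᵐ ω ∂P, ∀ t, 1 ≤ t → ‖w t ω‖ ≤ Cw)
    (hrefute : ∀ θ ∈ Θ, ∀ᵐ ω ∂P, ∀ x ∈ Θ, x ≠ θ →
      ∃ s, m ≤ s ∧ Cw < ‖predictionError f f' θ (e θ) w x s ω‖) :
    Identifiable P Θ f f' e w := by
  rcases Θ.eq_empty_or_nonempty with rfl | hne
  · exact ⟨fun _ _ => 0, fun _ => measurable_const, fun θ hθ => hθ.elim⟩
  have hlossx : ∀ t (d : Fin t → Vec p × Vec r), Continuous fun x => loss f f' Cw x d :=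
    fun t d => (continuous_loss hf hf' Cw t).comp₂ continuous_id continuous_const
  have hlossd : ∀ t x, Measurable fun d : Fin t → Vec p × Vec r => loss f f' Cw x d :=
    fun t x => ((continuous_loss hf hf' Cw t).comp₂ continuous_const continuous_id).measurable
  choose est hest hestΘ hestlt using fun t : ℕ => exists_measurable_mem_of_isOpen hne
    (s := fun d : Fin t → Vec p × Vec r => {x | loss f f' Cw x d < 1 / ((t : ℝ) + 1)})
    (fun d => isOpen_lt (hlossx t d) continuous_const)
    (fun x _ => measurableSet_lt (hlossd t x) measurable_const)
  refine ⟨est, hest, fun θ hθ => ?_⟩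
  filter_upwards [hw, hrefute θ hθ] with ω hωw hω
  refine tendsto_of_monotone_of_tendsto_zero
    (L := fun t x => loss f f' Cw x (data f f' θ (e θ) w t ω)) hΘ
    (fun t => (hlossx t _).lowerSemicontinuous) (loss_data_mono Cw ω)
    (fun x hx hxθ => ?_) (fun t => hestΘ t _) ?_
  · obtain ⟨s, hs, hlt⟩ := hω x hx hxθ
    exact ⟨s + 1, loss_data_pos hs hlt⟩
  · refine squeeze_zero (fun t => loss_nonneg Cw _ _) (fun t => (hestlt t _ ⟨θ, hθ, ?_⟩).le)
      tendsto_one_div_add_atTop_nhds_zero_nat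
    rw [Set.mem_ofPred_eq, loss_data_self hωw]
    positivity

end Estimation

theorem isCompact_hyperrectangle {n : ℕ} (a b : Fin n → ℝ) : IsCompact (hyperrectangle a b) := by
  have h : hyperrectangle a b = WithLp.ofLp ⁻¹' Set.Icc a b := by
    ext x
    simp [hyperrectangle, Set.mem_Icc, Pi.le_def, forall_and]
  rw [h]
  exact (PiLp.homeomorph 2 fun _ : Fin n => ℝ).isCompact_preimage.2 isCompact_Icc

end ControlSystem

end

open ControlSystem in
theorem theorem2p1_general {Ω : Type*} [MeasurableSpace Ω] (P : Measure Ω)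
    [IsProbabilityMeasure P] {n r p m : ℕ} {Θ : Set (Vec n)} (hΘ : IsCompact Θ)
    (f : Vec n → Regressor p m → Vec p) (f' : Vec r → Regressor p m → Vec p)
    (hf : Continuous (Function.uncurry f)) (hf' : Continuous (Function.uncurry f'))
    (Cw Cu C : ℝ) (hCw : 0 < Cw) (w : ℕ → Ω → Vec p) (hw : Noise P Cw w)
    (e : Vec n → Experiment Ω r p m) (he : ∀ θ ∈ Θ, Admissible P Cu (e θ))
    (hindep : ∀ θ ∈ Θ, IndepOfPast P (e θ) w)
    (hrec : ∀ θ ∈ Θ, Recurrent P f f' θ (e θ) w C) :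
    (∃ C₀ : ℝ, 0 < C₀ ∧ ∀ θ ∈ Θ, DriftBound P f f' θ (e θ) w C C₀) ∧
    ∀ C₀ : ℝ, (∀ θ ∈ Θ, DriftBound P f f' θ (e θ) w C C₀) →
      (∀ x ∈ Θ, ∀ x' ∈ Θ, x ≠ x' →
        ENNReal.ofReal (1 / Cw) < symLowerDensity (excitationSet f x x')
          fun _ : Fin m => Metric.closedBall (0 : Vec p) C₀) →
      Identifiable P Θ f f' e w := by
  refine ⟨exists_pos_forall_driftBound hΘ hf hf' hw he C, fun C₀ hdrift hdens => ?_⟩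
  refine identifiable_of_ae_exists_lt_norm_predictionError hΘ hf hf' hw.ae_norm_le fun θ hθ => ?_
  have hlocal : ∀ x ∈ Θ \ {θ}, ∃ U ∈ 𝓝 x, ∀ᵐ ω ∂P, ∀ x' ∈ U,
      ∃ s, m ≤ s ∧ Cw < ‖predictionError f f' θ (e θ) w x' s ω‖ := fun x hx =>
    exists_nhds_ae_exists_lt_norm_predictionError hf hf' hCw hw (he θ hθ) (hindep θ hθ)
      (hrec θ hθ) (hdrift θ hθ) (hdens θ hθ x hx.1 (Ne.symm hx.2))
  choose! U hU hUae using hlocal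
  obtain ⟨T, hTsub, hTcount, hTcover⟩ := TopologicalSpace.countable_cover_nhdsWithin
    fun x hx => mem_nhdsWithin_of_mem_nhds (hU x hx)
  filter_upwards [(ae_ball_iff hTcount).2 fun x hx => hUae x (hTsub hx)] with ω hω x hx hxθ
  obtain ⟨x₀, hx₀, hxU⟩ := Set.mem_iUnion₂.1 (hTcover ⟨hx, hxθ⟩)
  exact hω x₀ hx₀ x hxU

theorem theorem2p1 {Ω : Type*} [MeasurableSpace Ω] (P : Measure Ω) [IsProbabilityMeasure P]
    {n r p m : ℕ} (hm : 1 ≤ m)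
    (a b : Fin n → ℝ) (hab : ∀ i, a i < b i)
    (f : ControlSystem.Vec n → ControlSystem.Regressor p m → ControlSystem.Vec p)
    (f' : ControlSystem.Vec r → ControlSystem.Regressor p m → ControlSystem.Vec p)
    (hf : Continuous (Function.uncurry f)) (hf' : Continuous (Function.uncurry f'))
    (Cw Cu C : ℝ) (hCw : 0 < Cw) (hCu : 0 < Cu) (hC : 0 < C)
    (w : ℕ → Ω → ControlSystem.Vec p) (hw : ControlSystem.Noise P Cw w)
    (e : ControlSystem.Vec n → ControlSystem.Experiment Ω r p m)
    (he : ∀ θ ∈ ControlSystem.hyperrectangle a b, ControlSystem.Admissible P Cu (e θ))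
    (hindep : ∀ θ ∈ ControlSystem.hyperrectangle a b, ControlSystem.IndepOfPast P (e θ) w)
    (hrec : ∀ θ ∈ ControlSystem.hyperrectangle a b,
      ControlSystem.Recurrent P f f' θ (e θ) w C) :
    (∃ C₀ : ℝ, 0 < C₀ ∧ ∀ θ ∈ ControlSystem.hyperrectangle a b,
      ControlSystem.DriftBound P f f' θ (e θ) w C C₀) ∧
    ∀ C₀ : ℝ, 0 < C₀ →
      (∀ θ ∈ ControlSystem.hyperrectangle a b,
        ControlSystem.DriftBound P f f' θ (e θ) w C C₀) →
      (∀ x ∈ ControlSystem.hyperrectangle a b, ∀ x' ∈ ControlSystem.hyperrectangle a b, x ≠ x' →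
        ENNReal.ofReal (1 / Cw) <
          ControlSystem.symLowerDensity (ControlSystem.excitationSet f x x')
            (fun _ : Fin m => Metric.closedBall (0 : ControlSystem.Vec p) C₀)) →
      ControlSystem.Identifiable P (ControlSystem.hyperrectangle a b) f f' e w := by
  obtain ⟨hbound, hident⟩ := theorem2p1_general P (ControlSystem.isCompact_hyperrectangle a b)
    f f' hf hf' Cw Cu C hCw w hw e he hindep hrec
  exact ⟨hbound, fun C₀ _ => hident C₀⟩
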